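/- Let $\mathbb F$ be an algebraically closed field of characteristic $p>3$, let $\alpha\in\mathbb F\setminus\{0,-1\}$, and let $\mathfrak g=D(2,1;\alpha)$ be the 17-dimensional Lie superalgebra with $\mathfrak g_{\bar 0}=\mathrm{sl}(2)_1\oplus\mathrm{sl}(2)_2\oplus\mathrm{sl}(2)_3$ and $\mathfrak g_{\bar 1}=V_1\boxtimes V_2\boxtimes V_3$, where $V_i$ is the natural $\mathrm{sl}(2)_i$-module with basis $\omega_i,\omega_{-i}$. Let $h_i,e_i,f_i$ be the standard basis of $\mathrm{sl}(2)_i$ ($[e_i,f_i]=h_i$, $[h_i,e_i]=2e_i$, $[h_i,f_i]=-2f_i$, $e_i\omega_{-i}=\omega_i$, $f_i\omega_i=\omega_{-i}$, $h_i\omega_{\pm i}=\pm\omega_{\pm i}$). Write $x_1,x_2,x_3,x_4$ for $\omega_1\otimes\omega_{\pm2}\otimes\omega_{\pm3}$ with signs $(+,+),(+,-),(-,+),(-,-)$, and $y_1,\dots,y_4$ for the same with $\omega_{-1}$ in place of $\omega_1$. The nonzero brackets of odd basis vectors are, up to the symmetry $[u,v]=[v,u]$, \begin{align*} &[x_1,y_2]=-2e_2,\quad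 [x_1,y_3]=-2\alpha e_3,\quad [x_1,y_4]=-(1+\alpha)h_1+h_2+\alpha h_3,\\ &[x_2,y_1]=2e_2,\quad [x_2,y_4]=2\alpha f_3,\quad [x_2,y_3]=(1+\alpha)h_1-h_2+\alpha h_3,\\ &[x_3,y_1]=2\alpha e_3,\quad [x_3,y_4]=2f_2,\quad [x_3,y_2]=(1+\alpha)h_1+h_2-\alpha h_3,\\ &[x_4,y_2]=-2\alpha f_3,\quad [x_4,y_3]=-2f_2,\quad [x_4,y_1]=-(1+\alpha)h_1-h_2-\alpha h_3,\\ &[y_2,y_3]=2(1+\alpha)f_1,\quad [y_1,y_4]=-2(1+\alpha)f_1,\quad [x_2,x_3]=-2(1+\alpha)e_1,\quad [x_1,x_4]=2(1+\alpha)e_1. \end{align*} Let $\mathfrak h=\mathrm{span}\{h_1,h_2,h_3\}$ and $\mathfrak n^+=\mathrm{span}\{e_1,e_2,e_3,x_1,x_2,x_3,x_4\}$, and let $[p]$ be the $p$-mapping on $\mathfrak g_{\bar 0}$ with $h_i^{[p]}=h_i$, $e_i^{[p]}=f_i^{[p]}=0$. For $\chi\in\mathfrak g_{\bar 0}^*$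 and a restricted subalgebra $\mathfrak s\subseteq\mathfrak g$, let $u_\chi(\mathfrak s)$ be the quotient of the universal enveloping algebra of $\mathfrak s$ by the ideal generated by the elements $x^p-x^{[p]}-\chi(x)^p$, $x\in\mathfrak s_{\bar 0}$. Let $\chi\in\mathfrak g_{\bar 0}^*$ vanish on $\mathfrak n^+\cap\mathfrak g_{\bar 0}$, and let $\lambda\in\mathfrak h^*$ satisfy $\lambda(h)^p-\lambda(h^{[p]})=\chi(h)^p$ for all $h\in\mathfrak h$. Let $Z=Z_\chi(\lambda)=u_\chi(\mathfrak g)\otimes_{u_\chi(\mathfrak h\oplus\mathfrak n^+)}K_\lambda$ be the baby Verma module, where $K_\lambda=\mathbb F v$ with $v$ even, $hv=\lambda(h)v$ for $h\in\mathfrak h$ and $\mathfrak n^+v=0$. A homogeneous linear map $\varphi:\mathfrak g\to Z$ of parity $|\varphi|$ is a derivation if $\varphi([x,y])=(-1)^{|\varphi||x|}x\varphi(y)-(-1)^{|y|(|\varphi|+|x|)}y\varphi(x)$ for all homogeneous $x,y\in\mathfrak g$. Let $\mathrm{Der}(\mathfrak g,Z)$ be the span of the homogeneous derivations, and let $\mathrm{Ider}(\mathfrak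 g,Z)$ be the span of the inner derivations $\mathfrak D_m$ with $m\in Z$ homogeneous, where $\mathfrak D_m(x)=(-1)^{|x||m|}xm$ for homogeneous $x\in\mathfrak g$. A subscript $(0)$ denotes the subspace of those $\varphi$ with $\varphi(\mathfrak g_\beta)\subseteq Z_\beta$ for all $\beta\in\mathfrak h^*$, where $\mathfrak g_\beta$ and $Z_\beta$ are the weight spaces with respect to $\mathfrak h$. Put $\mathrm H^1(\mathfrak g,Z)=\mathrm{Der}(\mathfrak g,Z)/\mathrm{Ider}(\mathfrak g,Z)$. If $\chi(f_1)^p\neq0$, then every $\varphi\in\mathrm{Der}(\mathfrak g,Z)_{(0)}$ lies in $\mathrm{Ider}(\mathfrak g,Z)_{(0)}$, and $\mathrm H^1(\mathfrak g,Z)=0$. -/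

import Mathlib

open scoped TensorProduct

noncomputable section

namespace D21

/-! ### The Lie superalgebra `D(2,1;α)` -/

/-- Labels of the standard basis of `D(2,1;α)`.  Indices are shifted by one:
`h i`, `e i`, `f i` (`i = 0,1,2`) is the standard basis of the `(i+1)`-st copy of `sl(2)`, and
`x k`, `y k` (`k = 0,1,2,3`) are the tensors `ω_{±1} ⊗ ω_{±2} ⊗ ω_{±3}`:
`x 0, x 1, x 2, x 3 = (+++), (++-), (+-+), (+--)` and
`y 0, y 1, y 2, y 3 = (-++), (-+-), (--+), (---)`. -/
inductive Idx : Type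
  | h (i : Fin 3)
  | e (i : Fin 3)
  | f (i : Fin 3)
  | x (k : Fin 4)
  | y (k : Fin 4)
  deriving DecidableEq, Fintype

open Idx

/-- The parity of a basis vector. -/
def par : Idx → ZMod 2
  | h _ => 0
  | e _ => 0
  | f _ => 0
  | x _ => 1
  | y _ => 1

/-- The underlying 17-dimensional vector space. -/
abbrev G (F : Type*) : Type _ := Idx → F

/-- The basis vector with label `a`. -/
def bv (F : Type*) [Zero F] [One F] (a : Idx) : G F := Pi.single a 1

/-- The listed brackets of basis vectors (each unordered pair is listed in at most one order; the
pairs that are not listed, in either order, have bracket zero). -/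
def half {F : Type*} [CommRing F] (α : F) : Idx → Idx → G F
  -- the three copies of `sl(2)`
  | e i, f j => if i = j then bv F (h i) else 0
  | h i, e j => if i = j then (2 : F) • bv F (e i) else 0
  | h i, f j => if i = j then (-2 : F) • bv F (f i) else 0
  -- the first copy acting on the odd part
  | h 0, x k => bv F (x k)
  | h 0, y k => -bv F (y k)
  | e 0, y k => bv F (x k)
  | f 0, x k => bv F (y k)
  -- the second copy acting on the odd part
  | h 1, x k => if k = 0 ∨ k = 1 then bv F (x k) else -bv F (x k)
  | h 1, y k => if k = 0 ∨ k = 1 then bv F (y k) else -bv F (y k)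
  | e 1, x 2 => bv F (x 0)
  | e 1, x 3 => bv F (x 1)
  | e 1, y 2 => bv F (y 0)
  | e 1, y 3 => bv F (y 1)
  | f 1, x 0 => bv F (x 2)
  | f 1, x 1 => bv F (x 3)
  | f 1, y 0 => bv F (y 2)
  | f 1, y 1 => bv F (y 3)
  -- the third copy acting on the odd part
  | h 2, x k => if k = 0 ∨ k = 2 then bv F (x k) else -bv F (x k)
  | h 2, y k => if k = 0 ∨ k = 2 then bv F (y k) else -bv F (y k)
  | e 2, x 1 => bv F (x 0)
  | e 2, x 3 => bv F (x 2)
  | e 2, y 1 => bv F (y 0)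
  | e 2, y 3 => bv F (y 2)
  | f 2, x 0 => bv F (x 1)
  | f 2, x 2 => bv F (x 3)
  | f 2, y 0 => bv F (y 1)
  | f 2, y 2 => bv F (y 3)
  -- brackets of odd elements
  | x 0, y 1 => (-2 : F) • bv F (e 1)
  | x 0, y 2 => (-2 * α) • bv F (e 2)
  | x 0, y 3 => -(1 + α) • bv F (h 0) + bv F (h 1) + α • bv F (h 2)
  | x 1, y 0 => (2 : F) • bv F (e 1)
  | x 1, y 3 => (2 * α) • bv F (f 2)
  | x 1, y 2 => (1 + α) • bv F (h 0) - bv F (h 1) + α • bv F (h 2)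
  | x 2, y 0 => (2 * α) • bv F (e 2)
  | x 2, y 3 => (2 : F) • bv F (f 1)
  | x 2, y 1 => (1 + α) • bv F (h 0) + bv F (h 1) - α • bv F (h 2)
  | x 3, y 1 => (-2 * α) • bv F (f 2)
  | x 3, y 2 => (-2 : F) • bv F (f 1)
  | x 3, y 0 => -(1 + α) • bv F (h 0) - bv F (h 1) - α • bv F (h 2)
  | y 1, y 2 => (2 * (1 + α)) • bv F (f 0)
  | y 0, y 3 => (-2 * (1 + α)) • bv F (f 0)
  | x 1, x 2 => (-2 * (1 + α)) • bv F (e 0)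
  | x 0, x 3 => (2 * (1 + α)) • bv F (e 0)
  | _, _ => 0

/-- The bracket of two basis vectors, `[a, b] = -(-1)^{|a||b|} [b, a]`. -/
def tab {F : Type*} [CommRing F] (α : F) (a b : Idx) : G F :=
  half α a b - (-1 : F) ^ (par a * par b).val • half α b a

variable {F : Type*} [Field F]

/-- The bracket of `D(2,1;α)`. -/
def br (α : F) : G F →ₗ[F] G F →ₗ[F] G F :=
  (Pi.basisFun F Idx).constr F fun a => (Pi.basisFun F Idx).constr F fun b => tab α a b

variable (F) in
/-- The subspace spanned by a set of basis vectors. -/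
def spanOf (s : Set Idx) : Submodule F (G F) := Submodule.span F (bv F '' s)

variable (F) in
/-- The homogeneous components `𝔤_0` (`i = 0`) and `𝔤_1` (`i = 1`). -/
def gr (i : ZMod 2) : Submodule F (G F) := spanOf F {a | par a = i}

variable (F) in
/-- The Cartan subalgebra `𝔥`, spanned by `h_1, h_2, h_3`. -/
def cartan : Submodule F (G F) := spanOf F (Set.range h)

variable (F) in
/-- `𝔫⁺`, spanned by the `e_i` and the `x_k`. -/
def nplus : Submodule F (G F) := spanOf F (Set.range e ∪ Set.range x)

variable (F) in
/-- `𝔥 ⊕ 𝔫⁺`. -/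
def borel : Submodule F (G F) := cartan F ⊔ nplus F

/-- The `p`-mapping on `𝔤_0 = sl(2) ⊕ sl(2) ⊕ sl(2)`.  On each copy of `sl(2)` it is the `p`-th
power of 2×2 matrices: `X = a h + b e + c f` has `X² = (a² + b c) · 1`, so
`X ^ p = (a² + b c) ^ ((p - 1) / 2) • X` for odd `p`.  It is the unique `p`-mapping with
`h_i ↦ h_i`, `e_i ↦ 0`, `f_i ↦ 0`.  (Only its values on `𝔤_0` are used.) -/
def pMap (p : ℕ) (v : G F) : G F
  | h i => (v (h i) ^ 2 + v (e i) * v (f i)) ^ ((p - 1) / 2) * v (h i)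
  | e i => (v (h i) ^ 2 + v (e i) * v (f i)) ^ ((p - 1) / 2) * v (e i)
  | f i => (v (h i) ^ 2 + v (e i) * v (f i)) ^ ((p - 1) / 2) * v (f i)
  | x _ => 0
  | y _ => 0

/-! ### Reduced enveloping algebras -/

/-- The defining relations of the `χ`-reduced enveloping algebra of a restricted subalgebra `S`:
`x y = (-1)^{|x||y|} y x + [x, y]` for homogeneous `x, y` in `S`, and
`x ^ p = x^{[p]} + χ(x) ^ p` for even `x` in `S`. -/
inductive RedRel (α : F) (p : ℕ) (χ : Module.Dual F (gr F 0)) (S : Submodule F (G F)) :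
    TensorAlgebra F S → TensorAlgebra F S → Prop
  | lie (i j : ZMod 2) (u v w : S) (hu : (u : G F) ∈ gr F i) (hv : (v : G F) ∈ gr F j)
      (hw : (w : G F) = br α u v) :
      RedRel α p χ S (TensorAlgebra.ι F u * TensorAlgebra.ι F v)
        ((-1 : F) ^ (i * j).val • (TensorAlgebra.ι F v * TensorAlgebra.ι F u)
          + TensorAlgebra.ι F w)
  | pow (u w : S) (hu : (u : G F) ∈ gr F 0) (hw : (w : G F) = pMap p (u : G F)) :
      RedRel α p χ S (TensorAlgebra.ι F u ^ p)
        (TensorAlgebra.ι F w + algebraMap F _ (χ ⟨u, hu⟩ ^ p))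

/-- The `χ`-reduced enveloping algebra `u_χ(S)` of a restricted subalgebra `S` of `D(2,1;α)`. -/
def RedEnv (α : F) (p : ℕ) (χ : Module.Dual F (gr F 0)) (S : Submodule F (G F)) : Type _ :=
  RingQuot (RedRel α p χ S)

instance (α : F) (p : ℕ) (χ : Module.Dual F (gr F 0)) (S : Submodule F (G F)) :
    Ring (RedEnv α p χ S) :=
  inferInstanceAs (Ring (RingQuot (RedRel α p χ S)))

instance (α : F) (p : ℕ) (χ : Module.Dual F (gr F 0)) (S : Submodule F (G F)) :
    Algebra F (RedEnv α p χ S) :=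
  inferInstanceAs (Algebra F (RingQuot (RedRel α p χ S)))

/-- The quotient map from the tensor algebra. -/
def RedEnv.mk (α : F) (p : ℕ) (χ : Module.Dual F (gr F 0)) (S : Submodule F (G F)) :
    TensorAlgebra F S →ₐ[F] RedEnv α p χ S :=
  RingQuot.mkAlgHom F (RedRel α p χ S)

lemma RedEnv.mk_rel (α : F) (p : ℕ) (χ : Module.Dual F (gr F 0)) (S : Submodule F (G F))
    {a b : TensorAlgebra F S} (hab : RedRel α p χ S a b) :
    RedEnv.mk α p χ S a = RedEnv.mk α p χ S b :=
  RingQuot.mkAlgHom_rel F hab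

/-- Algebra maps out of the `χ`-reduced enveloping algebra. -/
def RedEnv.lift (α : F) (p : ℕ) (χ : Module.Dual F (gr F 0)) (S : Submodule F (G F))
    {A : Type*} [Ring A] [Algebra F A] (g : S →ₗ[F] A)
    (hg : ∀ a b, RedRel α p χ S a b → TensorAlgebra.lift F g a = TensorAlgebra.lift F g b) :
    RedEnv α p χ S →ₐ[F] A :=
  RingQuot.liftAlgHom F ⟨TensorAlgebra.lift F g, fun {a b} hab => hg a b hab⟩

/-- The canonical map `S → u_χ(S)`. -/
def RedEnv.ι (α : F) (p : ℕ) (χ : Module.Dual F (gr F 0)) (S : Submodule F (G F)) :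
    S →ₗ[F] RedEnv α p χ S :=
  (RedEnv.mk α p χ S).toLinearMap ∘ₗ TensorAlgebra.ι F

/-- `u_χ(𝔤)`. -/
abbrev U (α : F) (p : ℕ) (χ : Module.Dual F (gr F 0)) : Type _ := RedEnv α p χ ⊤

/-- The canonical map `𝔤 → u_χ(𝔤)`. -/
def ιU (α : F) (p : ℕ) (χ : Module.Dual F (gr F 0)) : G F →ₗ[F] U α p χ :=
  RedEnv.ι α p χ ⊤ ∘ₗ LinearMap.codRestrict ⊤ LinearMap.id fun _ => trivial

lemma RedEnv.lie_rel (α : F) (p : ℕ) (χ : Module.Dual F (gr F 0)) (S : Submodule F (G F))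
    (i j : ZMod 2) (u v w : S) (hu : (u : G F) ∈ gr F i) (hv : (v : G F) ∈ gr F j)
    (hw : (w : G F) = br α u v) :
    RedEnv.ι α p χ S u * RedEnv.ι α p χ S v =
      (-1 : F) ^ (i * j).val • (RedEnv.ι α p χ S v * RedEnv.ι α p χ S u) + RedEnv.ι α p χ S w := by
  simpa [RedEnv.ι] using RedEnv.mk_rel α p χ S (RedRel.lie (p := p) (χ := χ) i j u v w hu hv hw)

lemma RedEnv.pow_rel (α : F) (p : ℕ) (χ : Module.Dual F (gr F 0)) (S : Submodule F (G F))
    (u w : S) (hu : (u : G F) ∈ gr F 0) (hw : (w : G F) = pMap p (u : G F)) :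
    RedEnv.ι α p χ S u ^ p = RedEnv.ι α p χ S w + algebraMap F _ (χ ⟨u, hu⟩ ^ p) := by
  have := RedEnv.mk_rel α p χ S (RedRel.pow (α := α) (p := p) (χ := χ) u w hu hw)
  rw [map_pow, map_add, AlgHom.commutes] at this
  exact this

/-- The canonical algebra map `u_χ(S) → u_χ(𝔤)`. -/
def RedEnv.incl (α : F) (p : ℕ) (χ : Module.Dual F (gr F 0)) (S : Submodule F (G F)) :
    RedEnv α p χ S →ₐ[F] U α p χ :=
  RedEnv.lift α p χ S (ιU α p χ ∘ₗ S.subtype) (by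
    intro a b hab
    induction hab with
    | lie i j u v w hu hv hw =>
      have := RedEnv.lie_rel α p χ ⊤ i j ⟨u, trivial⟩ ⟨v, trivial⟩ ⟨w, trivial⟩ hu hv hw
      simp only [map_mul, map_add, map_smul, TensorAlgebra.lift_ι_apply]
      exact this
    | pow u w hu hw =>
      have := RedEnv.pow_rel α p χ ⊤ ⟨u, trivial⟩ ⟨w, trivial⟩ hu hw
      simp only [map_pow, map_add, AlgHom.commutes, TensorAlgebra.lift_ι_apply]
      rw [← map_pow (algebraMap F _)]
      exact this)

/-! ### The character of `u_χ(𝔥 ⊕ 𝔫⁺)` attached to a weight -/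

lemma bv_h_mem_cartan (i : Fin 3) : bv F (h i) ∈ cartan F :=
  Submodule.subset_span ⟨h i, ⟨i, rfl⟩, rfl⟩

lemma cartan_le_gr : cartan F ≤ gr F 0 :=
  Submodule.span_mono (Set.image_mono (by rintro _ ⟨i, rfl⟩; rfl))

/-- `Λ_χ = {λ ∈ 𝔥^* | λ(t)^p - λ(t^{[p]}) = χ(t)^p for all t ∈ 𝔥}`. -/
def weightSet (p : ℕ) (χ : Module.Dual F (gr F 0)) : Set (Module.Dual F (cartan F)) :=
  {l | ∀ t s : cartan F, (s : G F) = pMap p (t : G F) →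
    l t ^ p - l s = χ ⟨t, cartan_le_gr t.2⟩ ^ p}

/-- The linear form on `𝔤` that is `l` on `𝔥` and `0` on the root vectors.  On `𝔥 ⊕ 𝔫⁺` it gives
the action on the one-dimensional module `K_l`, where `𝔫⁺` acts by zero. -/
def extWeight (l : Module.Dual F (cartan F)) : G F →ₗ[F] F :=
  (Pi.basisFun F Idx).constr F fun
    | h i => l ⟨bv F (h i), bv_h_mem_cartan i⟩
    | _ => 0

lemma extWeight_bv (l : Module.Dual F (cartan F)) (a : Idx) :
    extWeight l (bv F a) =
      match a with
      | h i => l ⟨bv F (h i), bv_h_mem_cartan i⟩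
      | _ => 0 := by
  have : bv F a = Pi.basisFun F Idx a := by simp [bv]
  rw [this, extWeight, Module.Basis.constr_basis]

lemma br_bv (α : F) (a b : Idx) : br α (bv F a) (bv F b) = tab α a b := by
  have (c : Idx) : bv F c = Pi.basisFun F Idx c := by simp [bv]
  rw [this, this, br, Module.Basis.constr_basis, Module.Basis.constr_basis]

lemma mem_spanOf {s : Set Idx} {v : G F} : v ∈ spanOf F s ↔ ∀ a, a ∉ s → v a = 0 := by
  constructor
  · intro hv a ha
    induction hv using Submodule.span_induction with
    | mem x hx =>
      obtain ⟨b, hb, rfl⟩ := hx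
      have : a ≠ b := by rintro rfl; exact ha hb
      simp [bv, this]
    | zero => rfl
    | add x y _ _ hx hy => simp [hx, hy]
    | smul c x _ hx => simp [hx]
  · intro hv
    have : v = ∑ a, v a • bv F a := by
      ext b
      simp [bv, Finset.sum_apply, Pi.single_apply]
    rw [this]
    refine Submodule.sum_mem _ fun a _ => ?_
    by_cases ha : a ∈ s
    · exact Submodule.smul_mem _ _ (Submodule.subset_span ⟨a, ha, rfl⟩)
    · simp [hv a ha]

lemma extWeight_nplus (l : Module.Dual F (cartan F)) {u : G F} (hu : u ∈ nplus F) :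
    extWeight l u = 0 := by
  have : nplus F ≤ LinearMap.ker (extWeight l) := by
    rw [nplus, spanOf, Submodule.span_le]
    rintro _ ⟨a, ha, rfl⟩
    rcases ha with ⟨i, rfl⟩ | ⟨i, rfl⟩ <;> simp [extWeight_bv]
  exact this hu

lemma extWeight_cartan (l : Module.Dual F (cartan F)) (t : cartan F) :
    extWeight l t = l t := by
  obtain ⟨t, ht⟩ := t
  induction ht using Submodule.span_induction with
  | mem x hx =>
    obtain ⟨_, ⟨i, rfl⟩, rfl⟩ := hx
    simp [extWeight_bv]
  | zero => rw [map_zero]; exact (map_zero l).symm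
  | add x y hx hy h₁ h₂ =>
    simp only [map_add, h₁, h₂] at *
    rw [← map_add]; rfl
  | smul c x hx h₁ =>
    simp only [map_smul, h₁] at *
    rw [← map_smul]; rfl

lemma extWeight_odd (l : Module.Dual F (cartan F)) {u : G F} (hu : u ∈ gr F 1) :
    extWeight l u = 0 := by
  have : gr F 1 ≤ LinearMap.ker (extWeight l) := by
    rw [gr, spanOf, Submodule.span_le]
    rintro _ ⟨a, ha, rfl⟩
    cases a <;> simp_all [extWeight_bv, par]
  exact this hu

lemma borel_eq : borel F = spanOf F (Set.range h ∪ (Set.range e ∪ Set.range x)) := by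
  rw [borel, cartan, nplus, spanOf, spanOf, spanOf, ← Submodule.span_union, ← Set.image_union]

lemma extWeight_half (α : F) (l : Module.Dual F (cartan F)) {a b : Idx}
    (ha : a ∈ Set.range h ∪ (Set.range e ∪ Set.range x))
    (hb : b ∈ Set.range h ∪ (Set.range e ∪ Set.range x)) : extWeight l (half α a b) = 0 := by
  unfold half
  split <;> simp at ha hb ⊢ <;> (try split_ifs) <;> simp [extWeight_bv]

lemma extWeight_br (α : F) (l : Module.Dual F (cartan F)) {u v : G F} (hu : u ∈ borel F)
    (hv : v ∈ borel F) : extWeight l (br α u v) = 0 := by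
  rw [borel_eq] at hu hv
  induction hu, hv using Submodule.span_induction₂ with
  | mem_mem a b ha hb =>
    obtain ⟨a, ha, rfl⟩ := ha
    obtain ⟨b, hb, rfl⟩ := hb
    rw [br_bv, tab, map_sub, map_smul, extWeight_half α l ha hb, extWeight_half α l hb ha]
    simp
  | zero_left _ _ => simp
  | zero_right _ _ => simp
  | add_left _ _ _ _ _ _ h₁ h₂ => simp [h₁, h₂]
  | add_right _ _ _ _ _ _ h₁ h₂ => simp [h₁, h₂]
  | smul_left _ _ _ _ _ h₁ => simp [h₁]
  | smul_right _ _ _ _ _ h₁ => simp [h₁]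

lemma extWeight_pow (p : ℕ) (χ : Module.Dual F (gr F 0))
    (hχ : ∀ v : gr F 0, (v : G F) ∈ nplus F → χ v = 0)
    (l : Module.Dual F (cartan F)) (hl : l ∈ weightSet p χ) {u : G F} (hu : u ∈ borel F)
    (hu0 : u ∈ gr F 0) :
    extWeight l u ^ p = extWeight l (pMap p u) + χ ⟨u, hu0⟩ ^ p := by
  obtain ⟨t, ht, n, hn, rfl⟩ := Submodule.mem_sup.mp hu
  have hn0 : n ∈ gr F 0 := by
    have := Submodule.sub_mem _ hu0 (cartan_le_gr ht)
    simpa using this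
  have hχt : χ ⟨t + n, hu0⟩ = χ ⟨t, cartan_le_gr ht⟩ := by
    have h₁ : (⟨t + n, hu0⟩ : gr F 0) = ⟨t, cartan_le_gr ht⟩ + ⟨n, hn0⟩ := rfl
    rw [h₁, map_add, hχ ⟨n, hn0⟩ hn, add_zero]
  have htc := mem_spanOf.mp ht
  have hnc := mem_spanOf.mp hn
  have hs : pMap p t ∈ cartan F := by
    refine mem_spanOf.mpr fun a ha => ?_
    have := htc a ha
    cases a <;> simp_all [pMap]
  have hd : pMap p (t + n) - pMap p t ∈ nplus F := by
    refine mem_spanOf.mpr fun a ha => ?_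
    have h₁ := hnc a ha
    cases a with
    | h i =>
      have h₂ := hnc (f i) (by simp)
      have h₃ := htc (f i) (by simp)
      simp [pMap, h₁, h₂, h₃]
    | f i =>
      have h₃ := htc (f i) (by simp)
      simp [pMap, h₁, h₃]
    | e i => simp at ha
    | x k => simp [pMap]
    | y k => simp [pMap]
  have h₁ := extWeight_nplus l hd
  rw [map_sub, sub_eq_zero] at h₁
  have h₂ := hl ⟨t, ht⟩ ⟨pMap p t, hs⟩ rfl
  rw [h₁, hχt, map_add, extWeight_nplus l hn, add_zero]
  have h₃ := extWeight_cartan l ⟨t, ht⟩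
  have h₄ := extWeight_cartan l ⟨pMap p t, hs⟩
  simp only at h₃ h₄
  rw [h₃, h₄, ← h₂]
  ring

/-- The action of `u_χ(𝔥 ⊕ 𝔫⁺)` on the one-dimensional module `K_l`: `t ∈ 𝔥` acts as `l t`
and `𝔫⁺` acts as zero. -/
def charK (α : F) (p : ℕ) (χ : Module.Dual F (gr F 0))
    (hχ : ∀ v : gr F 0, (v : G F) ∈ nplus F → χ v = 0)
    (l : Module.Dual F (cartan F)) (hl : l ∈ weightSet p χ) :
    RedEnv α p χ (borel F) →ₐ[F] F :=
  RedEnv.lift α p χ (borel F) (extWeight l ∘ₗ (borel F).subtype) (by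
    intro a b hab
    induction hab with
    | lie i j u v w hu hv hw =>
      simp only [map_mul, map_add, map_smul, TensorAlgebra.lift_ι_apply, LinearMap.comp_apply,
        Submodule.subtype_apply, hw, extWeight_br α l u.2 v.2, add_zero, smul_eq_mul]
      by_cases hij : i = 1 ∧ j = 1
      · obtain ⟨rfl, rfl⟩ := hij
        simp [extWeight_odd l hu]
      · have : i * j = 0 := by
          clear hu hv; revert i j; decide
        simp [this, mul_comm]
    | pow u w hu hw =>
      simp only [map_pow, map_add, AlgHom.commutes, TensorAlgebra.lift_ι_apply,
        LinearMap.comp_apply, Submodule.subtype_apply, hw]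
      simpa using extWeight_pow p χ hχ l hl u.2 hu)

/-! ### The baby Verma module -/

section BabyVerma

variable (α : F) (p : ℕ) (χ : Module.Dual F (gr F 0))
  (hχ : ∀ v : gr F 0, (v : G F) ∈ nplus F → χ v = 0)
  (l : Module.Dual F (cartan F)) (hl : l ∈ weightSet p χ)

/-- The submodule of `u_χ(𝔤) ⊗_F K_l` generated by the elements `u b ⊗ k - u ⊗ b k` with
`u ∈ u_χ(𝔤)`, `b ∈ u_χ(𝔥 ⊕ 𝔫⁺)` and `k ∈ K_l = F`. -/
def balancing : Submodule (U α p χ) (U α p χ ⊗[F] F) :=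
  Submodule.span _ {m | ∃ (u : U α p χ) (b : RedEnv α p χ (borel F)) (k : F),
    m = (u * RedEnv.incl α p χ (borel F) b) ⊗ₜ[F] k - u ⊗ₜ[F] (charK α p χ hχ l hl b * k)}

/-- The baby Verma module `Z_χ(l) = u_χ(𝔤) ⊗_{u_χ(𝔥 ⊕ 𝔫⁺)} K_l`: the tensor product over the
noncommutative ring `u_χ(𝔥 ⊕ 𝔫⁺)` is the quotient of the tensor product over `F` by the
balancing relations. -/
abbrev Z : Type _ := (U α p χ ⊗[F] F) ⧸ balancing α p χ hχ l hl

/-- The action of `𝔤` on `Z_χ(l)`. -/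
def act : G F →ₗ[F] Module.End F (Z α p χ hχ l hl) :=
  (Algebra.lsmul F F (Z α p χ hχ l hl)).toLinearMap ∘ₗ ιU α p χ

/-- The homogeneous component of parity `i` of `u_χ(𝔤)`: it is spanned by the products of basis
vectors of `𝔤` whose parities add up to `i`. -/
def grU (i : ZMod 2) : Submodule F (U α p χ) :=
  Submodule.span F {u | ∃ w : List Idx, (w.map par).sum = i ∧
    u = (w.map fun a => ιU α p χ (bv F a)).prod}

/-- The homogeneous component of parity `i` of `Z_χ(l)`; the generator `1 ⊗ v` is even. -/
def grZ (i : ZMod 2) : Submodule F (Z α p χ hχ l hl) :=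
  Submodule.span F {m | ∃ u ∈ grU α p χ i, m = Submodule.Quotient.mk (u ⊗ₜ[F] (1 : F))}

end BabyVerma

/-! ### Superderivations and the first cohomology

`M` is a module over `𝔤 = D(2,1;α)`, given by the action `ρ` and the homogeneous components
`P 0`, `P 1`. -/

section Derivations

variable {M : Type*} [AddCommGroup M] [Module F M]

/-- `φ` is a homogeneous derivation of parity `k`: it maps `𝔤_i` to `M_{k+i}`, and
`φ [u, v] = (-1)^{k|u|} u φ(v) - (-1)^{|v|(k+|u|)} v φ(u)` for homogeneous `u, v`. -/
def IsHomDer (α : F) (ρ : G F →ₗ[F] Module.End F M) (P : ZMod 2 → Submodule F M) (k : ZMod 2)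
    (φ : G F →ₗ[F] M) : Prop :=
  (∀ i, ∀ u ∈ gr F i, φ u ∈ P (k + i)) ∧
  ∀ i j, ∀ u ∈ gr F i, ∀ v ∈ gr F j,
    φ (br α u v) = (-1 : F) ^ (k * i).val • ρ u (φ v) - (-1 : F) ^ (j * (k + i)).val • ρ v (φ u)

/-- `Der(𝔤, M)`, the span of the homogeneous derivations. -/
def Der (α : F) (ρ : G F →ₗ[F] Module.End F M) (P : ZMod 2 → Submodule F M) :
    Submodule F (G F →ₗ[F] M) :=
  Submodule.span F {φ | ∃ k, IsHomDer α ρ P k φ}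

/-- The inner derivation `𝔇_m` with respect to a homogeneous `m` of parity `k`:
`𝔇_m(u) = (-1)^{|u| k} u m` for homogeneous `u`. -/
def innerDer (ρ : G F →ₗ[F] Module.End F M) (k : ZMod 2) (m : M) : G F →ₗ[F] M :=
  (Pi.basisFun F Idx).constr F fun a => (-1 : F) ^ (par a * k).val • ρ (bv F a) m

/-- `Ider(𝔤, M)`, the span of the inner derivations with respect to homogeneous elements. -/
def Ider (ρ : G F →ₗ[F] Module.End F M) (P : ZMod 2 → Submodule F M) :
    Submodule F (G F →ₗ[F] M) :=
  Submodule.span F {φ | ∃ k, ∃ m ∈ P k, φ = innerDer ρ k m}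

/-- The weight space of weight `β ∈ 𝔥^*` for a family `T` of endomorphisms indexed by `𝔥`. -/
def wtSpace {V : Type*} [AddCommGroup V] [Module F V] (T : G F →ₗ[F] Module.End F V)
    (β : Module.Dual F (cartan F)) : Submodule F V :=
  ⨅ t : cartan F, Module.End.eigenspace (T t) (β t)

/-- The linear maps `φ : 𝔤 → M` with `φ(𝔤_β) ⊆ M_β` for all `β ∈ 𝔥^*`. -/
def weightPreserving (α : F) (ρ : G F →ₗ[F] Module.End F M) : Submodule F (G F →ₗ[F] M) where
  carrier := {φ | ∀ β, ∀ u ∈ wtSpace (br α) β, φ u ∈ wtSpace ρ β}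
  add_mem' h₁ h₂ β u hu := add_mem (h₁ β u hu) (h₂ β u hu)
  zero_mem' _ _ _ := zero_mem _
  smul_mem' c _ h₁ β u hu := Submodule.smul_mem _ c (h₁ β u hu)

/-- The `0`-weight derivation space `Der(𝔤, M)_(0)`. -/
def Der0 (α : F) (ρ : G F →ₗ[F] Module.End F M) (P : ZMod 2 → Submodule F M) :
    Submodule F (G F →ₗ[F] M) :=
  Der α ρ P ⊓ weightPreserving α ρ

/-- The inner derivations in the `0`-weight space, `Ider(𝔤, M)_(0)`. -/
def Ider0 (α : F) (ρ : G F →ₗ[F] Module.End F M) (P : ZMod 2 → Submodule F M) :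
    Submodule F (G F →ₗ[F] M) :=
  Ider ρ P ⊓ weightPreserving α ρ

/-- The first cohomology `H¹(𝔤, M) = Der(𝔤, M) / Ider(𝔤, M)`. -/
abbrev H1 (α : F) (ρ : G F →ₗ[F] Module.End F M) (P : ZMod 2 → Submodule F M) : Type _ :=
  Der α ρ P ⧸ (Ider ρ P).submoduleOf (Der α ρ P)

end Derivations

lemma bv_f_mem_gr (i : Fin 3) : bv F (f i) ∈ gr F 0 :=
  Submodule.subset_span ⟨f i, rfl, rfl⟩

end D21

end

namespace D21

open Idx

/-! The element `f_1` is even and `f_1 ^ p` acts on `Z` by the scalar `c = χ(f_1) ^ p`, which is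
nonzero; this alone makes every derivation inner, with no reduction to weight zero. After a sign
twist on the odd part, a derivation of parity `k` becomes a map `D` with `D [f_1, v] = f_1 D(v) - v
D(f_1)` for all `v`. Only brackets with the even element `f_1` enter, so no further super signs
appear.

Such a `D` gives operators on `Z × F`, an extension of the trivial module by `Z`, and their
commutators with the operator of `f_1` follow `ad f_1`. In characteristic `p`, `(ad a) ^ p = ad (a ^
p)`; since `(ad f_1) ^ 3 = 0` and `p ≥ 3`, the `p`-th power of the operator of `f_1` commutes with
all the others. Evaluating this at the vector `(0, 1)` gives `c D(v) = v f_1 ^ (p - 1) D(f_1)`, so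
`D` is inner with `m = c⁻¹ f_1 ^ (p - 1) D(f_1)` (`pow_char_apply_cocycle`, `IsHomDer.eq_innerDer`).
This `m` is homogeneous of parity `k` because `f_1` is even. -/

/-- In characteristic `p`, if `ad a` acts on the image of `Y` through a nilpotent map `d` with
`d ^ p = 0`, then `a ^ p` commutes with the image of `Y`. -/
lemma pow_char_commute_of_iterate_eq_zero {F V A : Type*} [Field F] (p : ℕ) [CharP F p]
    [Fact p.Prime] [AddCommGroup V] [Module F V] [Ring A] [Algebra F A] (a : A)
    (Y : V →ₗ[F] A) (d : V →ₗ[F] V) (hY : ∀ v, a * Y v - Y v * a = Y (d v)) {v : V}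
    (hd : (d ^ p) v = 0) : a ^ p * Y v = Y v * a ^ p := by
  have hiter (n : ℕ) :
      ((LinearMap.mulLeft F a - LinearMap.mulRight F a) ^ n) (Y v) = Y ((d ^ n) v) := by
    induction n with
    | zero => simp
    | succ n ih =>
      rw [pow_succ', pow_succ', Module.End.mul_apply, ih, Module.End.mul_apply, ← hY]
      simp
  -- The zero ring does not have characteristic `p`, so it is set aside.
  cases subsingleton_or_nontrivial A
  · exact Subsingleton.elim _ _
  have : CharP (Module.End F A) p := charP_of_injective_algebraMap (algebraMap F _).injective p
  have h := hiter p
  -- Left and right multiplication by `a` commute, so the `p`-th power of their difference is the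
  -- difference of their `p`-th powers.
  rw [sub_pow_char_of_commute p (LinearMap.commute_mulLeft_right (R := F) a a), hd, map_zero,
    LinearMap.pow_mulLeft, LinearMap.pow_mulRight, LinearMap.sub_apply] at h
  simpa [sub_eq_zero] using h

/-! ### Cocycles as extensions of the trivial module -/

section Extension

variable {F V M : Type*} [Field F] [AddCommGroup V] [Module F V] [AddCommGroup M] [Module F M]

/-- The action of `V` on the extension `M × F` of the trivial module by `M` attached to a
cochain `D : V → M`. -/
def extensionAct (ρ : V →ₗ[F] Module.End F M) (D : V →ₗ[F] M) : V →ₗ[F] Module.End F (M × F) where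
  toFun v := LinearMap.inl F M F ∘ₗ ((ρ v).coprod (LinearMap.toSpanSingleton F M (D v)))
  map_add' u v := by ext <;> simp
  map_smul' c v := by ext <;> simp

lemma extensionAct_apply (ρ : V →ₗ[F] Module.End F M) (D : V →ₗ[F] M) (v : V) (m : M) (t : F) :
    extensionAct ρ D v (m, t) = (ρ v m + t • D v, 0) := by
  simp [extensionAct]

lemma extensionAct_pow_apply (ρ : V →ₗ[F] Module.End F M) (D : V →ₗ[F] M) (v : V) (m : M)
    (n : ℕ) : (extensionAct ρ D v ^ n) (m, 0) = ((ρ v ^ n) m, 0) := by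
  induction n with
  | zero => simp
  | succ n ih =>
    rw [pow_succ', Module.End.mul_apply, ih, extensionAct_apply, pow_succ', Module.End.mul_apply]
    simp

/-- A cochain that satisfies the cocycle identity against an element `v₀` whose `p`-th power is
central is determined, after multiplication by that power, by its value at `v₀`. -/
lemma pow_char_apply_cocycle (p : ℕ) [CharP F p] [hp : Fact p.Prime]
    (ρ : V →ₗ[F] Module.End F M) (D : V →ₗ[F] M) (d : V →ₗ[F] V) (v₀ : V)
    (hρ : ∀ v, ρ v₀ * ρ v - ρ v * ρ v₀ = ρ (d v))
    (hD : ∀ v, D (d v) = ρ v₀ (D v) - ρ v (D v₀)) {v : V} (hd : (d ^ p) v = 0) :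
    (ρ v₀ ^ p) (D v) = ρ v ((ρ v₀ ^ (p - 1)) (D v₀)) := by
  have h := pow_char_commute_of_iterate_eq_zero p (extensionAct ρ D v₀) (extensionAct ρ D) d
    (fun w => by
      refine LinearMap.ext fun ⟨m, t⟩ => ?_
      have := LinearMap.congr_fun (hρ w) m
      simp only [LinearMap.sub_apply, Module.End.mul_apply] at this
      simp only [LinearMap.sub_apply, Module.End.mul_apply, extensionAct_apply, ← this, hD,
        zero_smul, add_zero, map_add, map_smul, Prod.mk_sub_mk, sub_zero, smul_sub]
      congr 1
      abel) hd
  -- At `(0, 1)` the first operator applied produces `D v` or `D v₀` in `M`; all later factors act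
  -- through `ρ`. One side thus keeps all `p` factors `ρ v₀`, the other only `p - 1`.
  have h₁ := LinearMap.congr_fun h (0, 1)
  obtain ⟨n, rfl⟩ : ∃ n, p = n + 1 := ⟨p - 1, (Nat.sub_add_cancel hp.out.one_le).symm⟩
  rw [Module.End.mul_apply, Module.End.mul_apply, extensionAct_apply, map_zero, zero_add, one_smul,
    extensionAct_pow_apply, pow_succ (extensionAct ρ D v₀), Module.End.mul_apply,
    extensionAct_apply ρ D v₀, map_zero, zero_add, one_smul, extensionAct_pow_apply,
    extensionAct_apply] at h₁
  simpa using congrArg Prod.fst h₁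

end Extension

/-! ### The adjoint action of `f_1` and homogeneous derivations -/

variable {F : Type*} [Field F]

lemma bv_mem_gr (a : Idx) : bv F a ∈ gr F (par a) :=
  Submodule.subset_span ⟨a, rfl, rfl⟩

lemma linearMap_ext_bv {V : Type*} [AddCommGroup V] [Module F V] {g g' : G F →ₗ[F] V}
    (hg : ∀ a, g (bv F a) = g' (bv F a)) : g = g' :=
  (Pi.basisFun F Idx).ext fun a => by simpa [bv] using hg a

/-- Under `sl(2)_1`, the algebra `𝔤` is a sum of modules of dimension at most three: the adjoint
one, copies of the natural one, and trivial ones. -/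
lemma br_f_zero_pow_three (α : F) : br α (bv F (f 0)) ^ 3 = 0 := by
  refine linearMap_ext_bv fun a => ?_
  rcases a with i | i | i | i | i <;> fin_cases i <;>
    simp [pow_succ, br_bv, tab, half, par]

lemma br_f_zero_mem_gr (α : F) (a : Idx) : br α (bv F (f 0)) (bv F a) ∈ gr F (par a) := by
  have hh : bv F (h 0) ∈ gr F 0 := bv_mem_gr (h 0)
  have hf : (2 : F) • bv F (f 0) ∈ gr F 0 := Submodule.smul_mem _ _ (bv_mem_gr (f 0))
  have hy (k : Fin 4) : bv F (y k) ∈ gr F 1 := bv_mem_gr (y k)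
  rw [br_bv]
  rcases a with i | i | i | i | i <;> fin_cases i <;> simp [tab, half, par, hh, hf, hy]

/-- The linear map that multiplies the odd part by `(-1) ^ k`. -/
noncomputable def signTwist (F : Type*) [Field F] (k : ZMod 2) : G F →ₗ[F] G F :=
  (Pi.basisFun F Idx).constr F fun a => (-1 : F) ^ (par a * k).val • bv F a

lemma signTwist_bv (k : ZMod 2) (a : Idx) :
    signTwist F k (bv F a) = (-1 : F) ^ (par a * k).val • bv F a := by
  have : bv F a = Pi.basisFun F Idx a := by simp [bv]
  rw [this, signTwist, Module.Basis.constr_basis, this]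

lemma signTwist_of_mem_gr (k : ZMod 2) {i : ZMod 2} {u : G F} (hu : u ∈ gr F i) :
    signTwist F k u = (-1 : F) ^ (i * k).val • u := by
  induction hu using Submodule.span_induction with
  | mem x hx =>
    obtain ⟨a, rfl, rfl⟩ := hx
    exact signTwist_bv k a
  | zero => simp
  | add x y _ _ hx hy => rw [map_add, hx, hy, smul_add]
  | smul c x _ hx => rw [map_smul, hx, smul_comm]

lemma innerDer_bv {M : Type*} [AddCommGroup M] [Module F M] (ρ : G F →ₗ[F] Module.End F M)
    (k : ZMod 2) (m : M) (a : Idx) :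
    innerDer ρ k m (bv F a) = (-1 : F) ^ (par a * k).val • ρ (bv F a) m := by
  have : bv F a = Pi.basisFun F Idx a := by simp [bv]
  rw [this, innerDer, Module.Basis.constr_basis, this]

/-- If `f_1 ^ p` acts on `M` by a nonzero scalar, then every homogeneous derivation is inner. -/
lemma IsHomDer.eq_innerDer {M : Type*} [AddCommGroup M] [Module F M] {p : ℕ} [CharP F p]
    [hp : Fact p.Prime] (hp3 : 3 ≤ p) {α : F} {ρ : G F →ₗ[F] Module.End F M}
    {P : ZMod 2 → Submodule F M} {k : ZMod 2} {φ : G F →ₗ[F] M} (hφ : IsHomDer α ρ P k φ)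
    (hρ : ∀ v, ρ (bv F (f 0)) * ρ v - ρ v * ρ (bv F (f 0)) = ρ (br α (bv F (f 0)) v))
    {c : F} (hc : c ≠ 0) (hpow : ρ (bv F (f 0)) ^ p = algebraMap F _ c) :
    φ = innerDer ρ k (c⁻¹ • (ρ (bv F (f 0)) ^ (p - 1)) (φ (bv F (f 0)))) := by
  have hpar : par (f 0) = 0 := rfl
  have hD (v) : (φ ∘ₗ signTwist F k) (br α (bv F (f 0)) v) =
      ρ (bv F (f 0)) ((φ ∘ₗ signTwist F k) v) - ρ v ((φ ∘ₗ signTwist F k) (bv F (f 0))) := by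
    suffices φ ∘ₗ signTwist F k ∘ₗ br α (bv F (f 0)) =
        ρ (bv F (f 0)) ∘ₗ φ ∘ₗ signTwist F k -
          ρ.flip ((φ ∘ₗ signTwist F k) (bv F (f 0))) from LinearMap.congr_fun this v
    refine linearMap_ext_bv fun a => ?_
    have h := hφ.2 0 (par a) (bv F (f 0)) (bv_mem_gr (f 0)) (bv F a) (bv_mem_gr a)
    -- The twist sign on `a` cancels the sign `(-1) ^ (|a| k)` in front of the second term of the
    -- derivation rule.
    have hsq : (-1 : F) ^ (par a * k).val * (-1 : F) ^ (par a * k).val = 1 := by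
      rw [← mul_pow]; simp
    simp only [LinearMap.comp_apply, LinearMap.sub_apply, LinearMap.flip_apply,
      signTwist_of_mem_gr k (br_f_zero_mem_gr α a), signTwist_bv, map_smul, h, mul_zero, add_zero,
      ZMod.val_zero, pow_zero, one_smul, smul_sub, smul_smul, hsq, hpar, zero_mul]
  refine linearMap_ext_bv fun a => ?_
  have hd : (br α (bv F (f 0)) ^ p) (bv F a) = 0 := by
    rw [pow_eq_zero_of_le hp3 (br_f_zero_pow_three α), LinearMap.zero_apply]
  have h := pow_char_apply_cocycle p ρ (φ ∘ₗ signTwist F k) _ (bv F (f 0)) hρ hD hd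
  simp only [LinearMap.comp_apply, signTwist_bv, map_smul, hpow, Module.algebraMap_end_apply, hpar,
    zero_mul, ZMod.val_zero, pow_zero, one_smul] at h
  -- The sign in `innerDer` meets the twist sign once more, and their product is `1`.
  rw [innerDer_bv, map_smul, ← h, smul_comm _ c, inv_smul_smul₀ hc, smul_smul, ← mul_pow]
  simp

/-! ### The action of `f_1` on the baby Verma module -/

section BabyVerma

variable (α : F) (p : ℕ) (χ : Module.Dual F (gr F 0))

lemma ιU_f_zero_lie (v : G F) :
    ιU α p χ (bv F (f 0)) * ιU α p χ v - ιU α p χ v * ιU α p χ (bv F (f 0)) =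
      ιU α p χ (br α (bv F (f 0)) v) := by
  suffices LinearMap.mulLeft F (ιU α p χ (bv F (f 0))) ∘ₗ ιU α p χ -
      LinearMap.mulRight F (ιU α p χ (bv F (f 0))) ∘ₗ ιU α p χ =
        ιU α p χ ∘ₗ br α (bv F (f 0)) from LinearMap.congr_fun this v
  refine linearMap_ext_bv fun a => ?_
  have h := RedEnv.lie_rel α p χ ⊤ 0 (par a) ⟨bv F (f 0), trivial⟩ ⟨bv F a, trivial⟩
    ⟨br α (bv F (f 0)) (bv F a), trivial⟩ (bv_mem_gr (f 0)) (bv_mem_gr a) rfl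
  rw [zero_mul, ZMod.val_zero, pow_zero, one_smul] at h
  exact sub_eq_of_eq_add' h

lemma ιU_f_zero_pow (hp : 3 ≤ p) :
    ιU α p χ (bv F (f 0)) ^ p = algebraMap F _ (χ ⟨bv F (f 0), bv_f_mem_gr 0⟩ ^ p) := by
  have hmap : pMap p (bv F (f 0)) = 0 := by
    -- The factor `0 ^ ((p - 1) / 2)` in `pMap` vanishes only for a nonzero exponent.
    have : (p - 1) / 2 ≠ 0 := by omega
    funext a
    cases a <;> simp [pMap, bv, this]
  have h := RedEnv.pow_rel α p χ ⊤ ⟨bv F (f 0), trivial⟩ 0 (bv_f_mem_gr 0) hmap.symm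
  rw [map_zero, zero_add] at h
  exact h

variable (hχ : ∀ v : gr F 0, (v : G F) ∈ nplus F → χ v = 0)
  (l : Module.Dual F (cartan F)) (hl : l ∈ weightSet p χ)

/-- Prepending the even letter `f_1` to a word leaves its parity unchanged. This is what makes the
element defining the inner derivation homogeneous. -/
lemma act_f_zero_mem_grZ (k : ZMod 2) {m : Z α p χ hχ l hl} (hm : m ∈ grZ α p χ hχ l hl k) :
    act α p χ hχ l hl (bv F (f 0)) m ∈ grZ α p χ hχ l hl k := by
  have hU {u : U α p χ} (hu : u ∈ grU α p χ k) : ιU α p χ (bv F (f 0)) * u ∈ grU α p χ k := by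
    induction hu using Submodule.span_induction with
    | mem x hx =>
      obtain ⟨w, rfl, rfl⟩ := hx
      exact Submodule.subset_span ⟨f 0 :: w, by simp [par], by simp⟩
    | zero => simp
    | add x y _ _ hx hy => rw [mul_add]; exact add_mem hx hy
    | smul c x _ hx => rw [mul_smul_comm]; exact Submodule.smul_mem _ c hx
  induction hm using Submodule.span_induction with
  | mem x hx =>
    obtain ⟨u, hu, rfl⟩ := hx
    exact Submodule.subset_span ⟨_, hU hu, rfl⟩
  | zero => simp
  | add x y _ _ hx hy => rw [map_add]; exact add_mem hx hy
  | smul c x _ hx => rw [map_smul]; exact Submodule.smul_mem _ c hx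

/-- If `χ(f_1) ≠ 0`, every superderivation with values in the baby Verma module is inner. -/
lemma der_le_ider [CharP F p] (hp : 3 ≤ p) (hf : χ ⟨bv F (f 0), bv_f_mem_gr 0⟩ ^ p ≠ 0) :
    Der α (act α p χ hχ l hl) (grZ α p χ hχ l hl) ≤
      Ider (act α p χ hχ l hl) (grZ α p χ hχ l hl) := by
  have : Fact p.Prime := ⟨(CharP.char_is_prime_or_zero F p).resolve_right (by omega)⟩
  refine Submodule.span_le.mpr ?_
  rintro φ ⟨k, hφ⟩
  have hact (v) : act α p χ hχ l hl v =
      Algebra.lsmul F F (Z α p χ hχ l hl) (ιU α p χ v) := rfl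
  refine Submodule.subset_span ⟨k, _, ?_, hφ.eq_innerDer hp (fun v => ?_) hf ?_⟩
  · refine Submodule.smul_mem _ _ ?_
    have h₀ : φ (bv F (f 0)) ∈ grZ α p χ hχ l hl k := by
      simpa [par] using hφ.1 _ _ (bv_mem_gr (f 0))
    induction p - 1 with
    | zero => simpa using h₀
    | succ n ih =>
      rw [pow_succ', Module.End.mul_apply]
      exact act_f_zero_mem_grZ α p χ hχ l hl k ih
  · simp only [hact, ← map_mul, ← map_sub, ιU_f_zero_lie]
  · rw [hact, ← map_pow, ιU_f_zero_pow α p χ hp, AlgHom.commutes]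

end BabyVerma

end D21

theorem proposition3p3 {F : Type*} [Field F] [IsAlgClosed F] (p : ℕ) [CharP F p] (hp : 3 < p)
    (α : F) (hα₀ : α ≠ 0) (hα₁ : α ≠ -1)
    (χ : Module.Dual F (D21.gr F 0))
    (hχ : ∀ v : D21.gr F 0, (v : D21.G F) ∈ D21.nplus F → χ v = 0)
    (l : Module.Dual F (D21.cartan F)) (hl : l ∈ D21.weightSet p χ)
    (hf : χ ⟨D21.bv F (D21.Idx.f 0), D21.bv_f_mem_gr 0⟩ ^ p ≠ 0) :
    (∀ φ ∈ D21.Der0 α (D21.act α p χ hχ l hl) (D21.grZ α p χ hχ l hl),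
      φ ∈ D21.Ider0 α (D21.act α p χ hχ l hl) (D21.grZ α p χ hχ l hl)) ∧
    Subsingleton (D21.H1 α (D21.act α p χ hχ l hl) (D21.grZ α p χ hχ l hl)) := by
  have h := D21.der_le_ider α p χ hχ l hl hp.le hf
  -- The weight condition is the same on both sides, so it carries over unchanged.
  refine ⟨fun φ hφ => ⟨h hφ.1, hφ.2⟩, ?_⟩
  exact Submodule.Quotient.subsingleton_iff.mpr (Submodule.submoduleOf_eq_top.mpr h)
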